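/- Let $p,q,r,s$ be prime numbers, all congruent to $3$ modulo $4$, and let $\left(\frac{a}{\ell}\right)$ denote the Legendre symbol. Suppose that one of the following two conditions holds: (i) $\left(\frac{2}{r}\right)\neq\left(\frac{2}{s}\right)$, $\left(\frac{q}{r}\right)=\left(\frac{q}{s}\right)=\left(\frac{p}{q}\right)=1$ and $\left(\frac{p}{r}\right)=\left(\frac{p}{s}\right)=-1$; (ii) $\left(\frac{2}{r}\right)=\left(\frac{2}{s}\right)\neq\left(\frac{2}{q}\right)$, $\left(\frac{q}{r}\right)=\left(\frac{r}{s}\right)=\left(\frac{s}{q}\right)$ and $\left(\frac{pr}{s}\right)=\left(\frac{ps}{r}\right)=-1$. Then $K=\mathbb{Q}(\sqrt{p},\sqrt{qrs})$ is a Pólya field; that is, for every prime number $\ell$ and every integer $f\ge 1$, the product of all maximal ideals of the ring of integers $\mathcal{O}_K$ of norm $\ell^f$ (the unit ideal if there are none) is a principal ideal. -/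

import Mathlib

/-- The Ostrowski ideal `Π_n(K)`: the product of all maximal ideals of `𝓞 K` of absolute norm `n`
(the unit ideal if there are none). -/
noncomputable def ostrowskiIdeal (K : Type*) [Field K] [NumberField K] (n : ℕ) :
    Ideal (NumberField.RingOfIntegers K) :=
  ∏ᶠ I ∈ {I : Ideal (NumberField.RingOfIntegers K) | I.IsMaximal ∧ Ideal.absNorm I = n}, I

/-- The set of factors in `ostrowskiIdeal` is finite, so that the product has its usual meaning. -/
theorem finite_ostrowskiFactors (K : Type*) [Field K] [NumberField K] (n : ℕ) :
    {I : Ideal (NumberField.RingOfIntegers K) | I.IsMaximal ∧ Ideal.absNorm I = n}.Finite :=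
  (Ideal.finite_setOfPred_absNorm_le n).subset fun _ hI => hI.2.le

/-- A number field is a Pólya field if its Ostrowski ideals are principal for all prime powers. -/
def IsPolyaField (K : Type*) [Field K] [NumberField K] : Prop :=
  ∀ l f : ℕ, l.Prime → 0 < f → (ostrowskiIdeal K (l ^ f)).IsPrincipal

/-- The field `ℚ(√a, √b)`, as a subfield of `ℝ`. -/
noncomputable def adjoinSqrts (a b : ℕ) : IntermediateField ℚ ℝ :=
  IntermediateField.adjoin ℚ {Real.sqrt a, Real.sqrt b}

/-- The square root of a natural number is algebraic. -/
theorem isIntegral_sqrt_natCast (a : ℕ) : IsIntegral ℚ (Real.sqrt a) := by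
  refine IsIntegral.of_pow (n := 2) two_pos ?_
  rw [Real.sq_sqrt (Nat.cast_nonneg a)]
  simpa using isIntegral_algebraMap (R := ℚ) (A := ℝ) (x := (a : ℚ))

instance numberField_adjoinSqrts (a b : ℕ) : NumberField (adjoinSqrts a b) where
  to_charZero := inferInstance
  to_finiteDimensional := by
    unfold adjoinSqrts
    refine IntermediateField.finiteDimensional_adjoin ?_
    intro x hx
    rcases hx with rfl | rfl
    · exact isIntegral_sqrt_natCast a
    · exact isIntegral_sqrt_natCast b

/-! `K` is Galois over `ℚ`, so the primes above `l` share one norm and one ramification index `e`.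
Hence each Ostrowski ideal is trivial or the product `Π` of all primes above `l`, and `(l) = Π ^ e`.
If `e = 1`, `Π` is principal. Only primes `l ∣ 2pqrs` can ramify, and there `e ≤ 2`; so it suffices
that each such `l` is a unit times a square `x ^ 2`, since then `x` generates `Π` when `e = 2`
(`isPolyaField_of_isUnitMulSq`).

These relations come from Pell equations. For odd nonsquare `n`, factoring `x ^ 2 - 1` in the
solution of `x ^ 2 = n * y ^ 2 + 1` with least `y > 0` yields `a * u ^ 2 - b * v ^ 2 = c` with `a *
b = n` and `c = 1` or `2` (`exists_mul_sq_eq_mul_sq_add`). Then `(a * u + v * √n) ^ 2` is `a * c`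
times a unit (`isUnitMulSq_of_eq_add`). Modulo each prime divisor of `n` the equation imposes a
Legendre symbol condition (`eq_mul_of_mul_eq`); with quadratic reciprocity these leave almost no
choice for `a`. Taking `n = p` handles `2`; `n = qrs` and `n = pqrs` together separate `q`, `r`,
`s`. If `p = q`, possible only under (ii), `n = rs` replaces the last two. -/

open NumberField Ideal in
/-- The product of all primes of `𝓞 K` above the rational prime `l`. -/
noncomputable def primesOverProd (K : Type*) [Field K] [NumberField K] (l : ℕ) : Ideal (𝓞 K) :=
  ∏ᶠ P ∈ (span {(l : ℤ)}).primesOver (𝓞 K), P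

theorem isMaximal_span_natCast {l : ℕ} (hl : l.Prime) : (Ideal.span {(l : ℤ)}).IsMaximal :=
  PrincipalIdealRing.isMaximal_of_irreducible (Nat.prime_iff_prime_int.mp hl).irreducible

theorem span_natCast_ne_bot {l : ℕ} (hl : l.Prime) : Ideal.span {(l : ℤ)} ≠ ⊥ := by
  simpa using hl.ne_zero

/-! ### Galois action, inertia groups and the criterion for Pólya fields -/

section Galois

open NumberField Ideal

variable {K : Type*} [Field K] [NumberField K]

theorem liesOver_of_absNorm_eq_pow {l f : ℕ} (hl : l.Prime) {P : Ideal (𝓞 K)} (hP : P.IsMaximal)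
    (h : absNorm P = l ^ f) : P.LiesOver (span {(l : ℤ)}) := by
  have hmax := isMaximal_span_natCast hl
  have hmem : (l : 𝓞 K) ∈ P := by
    have := absNorm_mem P
    rw [h, Nat.cast_pow] at this
    exact hP.isPrime.mem_of_pow_mem f this
  refine ⟨hmax.eq_of_le (comap_ne_top _ hP.ne_top) ?_⟩
  rw [span_singleton_le_iff_mem, mem_comap]
  simpa using hmem

theorem isMaximal_of_mem_primesOver {K : Type*} [Field K] {l : ℕ} (hl : l.Prime) {P : Ideal (𝓞 K)}
    (hP : P ∈ (span {(l : ℤ)}).primesOver (𝓞 K)) : P.IsMaximal := by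
  have := hP.1
  have := hP.2
  have := isMaximal_span_natCast hl
  exact IsMaximal.of_liesOver_isMaximal P (span {(l : ℤ)})

theorem natCast_dvd_of_mem_primesOver {K : Type*} [Field K] {l : ℕ} {P : Ideal (𝓞 K)}
    (hP : P ∈ (span {(l : ℤ)}).primesOver (𝓞 K)) {n : ℤ} (hn : (n : 𝓞 K) ∈ P) : (l : ℤ) ∣ n := by
  rw [← mem_span_singleton, hP.2.over, mem_comap]
  simpa using hn

/-- `n` is a unit times a square in `K`. -/
def IsUnitMulSq (K : Type*) [Field K] [NumberField K] (n : ℕ) : Prop :=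
  ∃ (x : K) (u : (𝓞 K)ˣ), x ≠ 0 ∧ x ^ 2 = n * algebraMap (𝓞 K) K u

theorem IsUnitMulSq.exists_span_sq {n : ℕ} (h : IsUnitMulSq K n) :
    ∃ x : 𝓞 K, span {x} ^ 2 = span {(n : 𝓞 K)} := by
  obtain ⟨x, u, -, hx⟩ := h
  have hint : IsIntegral ℤ x := by
    refine IsIntegral.of_pow two_pos (hx ▸ ?_)
    exact by simpa using RingOfIntegers.isIntegral_coe ((n : 𝓞 K) * (u : 𝓞 K))
  obtain ⟨x, rfl⟩ : ∃ x' : 𝓞 K, algebraMap (𝓞 K) K x' = x := ⟨⟨x, hint⟩, rfl⟩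
  refine ⟨x, ?_⟩
  have : x ^ 2 = n * (u : 𝓞 K) := by
    apply FaithfulSMul.algebraMap_injective (𝓞 K) K
    simpa using hx
  rw [span_singleton_pow, this, span_singleton_mul_right_unit u.isUnit]

theorem exists_mem_primesOver {l : ℕ} (hl : l.Prime) :
    ∃ P, P ∈ (span {(l : ℤ)}).primesOver (𝓞 K) := by
  have := isMaximal_span_natCast hl
  obtain ⟨P⟩ := (inferInstance : Nonempty (primesOver (span {(l : ℤ)}) (𝓞 K)))
  exact ⟨P.1, P.2⟩

theorem apply_eq_or_eq_neg {x : K} {a : ℤ} (hx : x ^ 2 = a) (σ : Gal(K/ℚ)) :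
    σ x = x ∨ σ x = -x := by
  rw [← sq_eq_sq_iff_eq_or_eq_neg, ← map_pow, hx, map_intCast]

theorem apply_sub_mem_of_mem_inertia {P : Ideal (𝓞 K)} {σ : Gal(K/ℚ)}
    (hσ : σ ∈ P.inertia Gal(K/ℚ)) {x : K} (hx : IsIntegral ℤ x) :
    ∃ y ∈ P, algebraMap (𝓞 K) K y = σ x - x := by
  obtain ⟨x, rfl⟩ : ∃ x' : 𝓞 K, algebraMap (𝓞 K) K x' = x := ⟨⟨x, hx⟩, rfl⟩
  exact ⟨σ • x - x, hσ x, rfl⟩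

/-- An inertia group above a prime `l` not dividing `2 * a` fixes the square roots of `a`. -/
theorem apply_eq_of_mem_inertia {l : ℕ} {P : Ideal (𝓞 K)}
    (hP : P ∈ (span {(l : ℤ)}).primesOver (𝓞 K)) {x : K} {a : ℤ} (hx : x ^ 2 = a)
    (hl : Prime (l : ℤ)) (h2 : ¬ (l : ℤ) ∣ 2) (ha : ¬ (l : ℤ) ∣ a)
    {σ : Gal(K/ℚ)} (hσ : σ ∈ P.inertia Gal(K/ℚ)) : σ x = x := by
  refine (apply_eq_or_eq_neg hx σ).resolve_right fun h => ?_
  have hint : IsIntegral ℤ x := .of_pow two_pos (hx ▸ isIntegral_algebraMap (R := ℤ) (x := a))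
  obtain ⟨y, hyP, hy⟩ := apply_sub_mem_of_mem_inertia hσ hint
  -- Here `y = -2 * x` lies in `P`, so `P` contains the integer `4 * a`.
  have : y ^ 2 = ((2 * 2 * a : ℤ) : 𝓞 K) := by
    apply FaithfulSMul.algebraMap_injective (𝓞 K) K
    rw [map_pow, map_intCast, hy, h]
    push_cast
    rw [← hx]
    ring
  have := natCast_dvd_of_mem_primesOver hP (this ▸ P.pow_mem_of_mem hyP 2 two_pos)
  rw [hl.dvd_mul, hl.dvd_mul] at this
  tauto

/-- An inertia group above a prime `l` not dividing `a`, where `a % 4 = 1`, fixes the square roots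
of `a`. -/
theorem apply_eq_of_mem_inertia_of_emod_four {l : ℕ} {P : Ideal (𝓞 K)}
    (hP : P ∈ (span {(l : ℤ)}).primesOver (𝓞 K)) {x : K} {a : ℤ} (hx : x ^ 2 = a)
    (ha4 : a % 4 = 1) (ha : ¬ (l : ℤ) ∣ a)
    {σ : Gal(K/ℚ)} (hσ : σ ∈ P.inertia Gal(K/ℚ)) : σ x = x := by
  refine (apply_eq_or_eq_neg hx σ).resolve_right fun h => ?_
  obtain ⟨c, hc⟩ : ∃ c, a = 4 * c + 1 := ⟨a / 4, by omega⟩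
  -- The automorphism moves `(1 + x) / 2` by `-x`, without the factor `2` that spoils the argument
  -- at `l = 2`.
  have hint : IsIntegral ℤ ((1 + x) / 2) := by
    refine ⟨.X ^ 2 - .X - .C c, by monicity!, ?_⟩
    simp only [Polynomial.eval₂_sub, Polynomial.eval₂_X_pow, Polynomial.eval₂_X,
      Polynomial.eval₂_C]
    rw [hc] at hx
    push_cast at hx
    simp only [algebraMap_int_eq, eq_intCast]
    linear_combination hx / 4
  obtain ⟨y, hyP, hy⟩ := apply_sub_mem_of_mem_inertia hσ hint
  have : y ^ 2 = (a : 𝓞 K) := by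
    apply FaithfulSMul.algebraMap_injective (𝓞 K) K
    rw [map_pow, map_intCast, hy, map_div₀, map_add, map_one, map_ofNat, h, ← hx]
    ring
  exact ha (natCast_dvd_of_mem_primesOver hP (this ▸ P.pow_mem_of_mem hyP 2 two_pos))

/-- If automorphisms are determined on `x` and `z` with `x ^ 2 ∈ ℤ`, then a group of automorphisms
fixing `z` has at most two elements. -/
theorem card_inertia_le_two {P : Ideal (𝓞 K)} {x z : K} {a : ℤ} (hx : x ^ 2 = a)
    (hgen : ∀ σ τ : Gal(K/ℚ), σ x = τ x → σ z = τ z → σ = τ)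
    (hz : ∀ σ ∈ P.inertia Gal(K/ℚ), σ z = z) : Nat.card (P.inertia Gal(K/ℚ)) ≤ 2 := by
  have : ({x, -x} : Set K).ncard ≤ 2 :=
    (Set.ncard_insert_le x {-x}).trans (by rw [Set.ncard_singleton])
  refine le_trans ?_ this
  rw [← Nat.card_coe_set_eq]
  refine Nat.card_le_card_of_injective
    (fun σ : P.inertia Gal(K/ℚ) => (⟨σ.1 x, apply_eq_or_eq_neg hx σ.1⟩ : ({x, -x} : Set K))) ?_
  intro σ τ h
  refine Subtype.ext (hgen _ _ (congrArg Subtype.val h) ?_)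
  rw [hz _ σ.2, hz _ τ.2]

variable [IsGalois ℚ K]

theorem absNorm_of_mem_primesOver {l : ℕ} (hl : l.Prime) {P : Ideal (𝓞 K)}
    (hP : P ∈ (span {(l : ℤ)}).primesOver (𝓞 K)) :
    absNorm P = l ^ (span {(l : ℤ)}).inertiaDegIn (𝓞 K) := by
  have := hP.1
  have := hP.2
  have := isMaximal_span_natCast hl
  have := isMaximal_of_mem_primesOver hl hP
  rw [absNorm_eq_pow_inertiaDeg' P hl, inertiaDeg'_eq_inertiaDeg,
    inertiaDegIn_eq_inertiaDeg _ P Gal(K/ℚ)]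

/-- In a Galois number field, the Ostrowski ideal of `l ^ f` is trivial or contains all primes
above `l`. -/
theorem ostrowskiIdeal_eq_one_or {l : ℕ} (hl : l.Prime) (f : ℕ) :
    ostrowskiIdeal K (l ^ f) = 1 ∨ ostrowskiIdeal K (l ^ f) = primesOverProd K l := by
  by_cases hf : f = (span {(l : ℤ)}).inertiaDegIn (𝓞 K)
  · right
    refine finprod_mem_congr (Set.ext fun P => ⟨fun h => ?_, fun h => ?_⟩) fun _ _ => rfl
    · exact ⟨h.1.isPrime, liesOver_of_absNorm_eq_pow hl h.1 h.2⟩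
    · exact ⟨isMaximal_of_mem_primesOver hl h, hf ▸ absNorm_of_mem_primesOver hl h⟩
  · left
    have : {I : Ideal (𝓞 K) | I.IsMaximal ∧ absNorm I = l ^ f} = ∅ := by
      refine Set.eq_empty_of_forall_notMem fun P hP => hf ?_
      have := absNorm_of_mem_primesOver hl (P := P)
        ⟨hP.1.isPrime, liesOver_of_absNorm_eq_pow hl hP.1 hP.2⟩
      exact Nat.pow_right_injective hl.two_le (hP.2.symm.trans this)
    rw [ostrowskiIdeal, this, finprod_mem_empty]

/-- The Galois group permutes the primes above `l` transitively, so they all occur with the same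
exponent. -/
theorem span_natCast_eq_primesOverProd_pow {l : ℕ} (hl : l.Prime) :
    span {(l : 𝓞 K)} = primesOverProd K l ^ (span {(l : ℤ)}).ramificationIdxIn (𝓞 K) := by
  have := isMaximal_span_natCast hl
  have h := map_algebraMap_eq_finsetProd_pow (R := 𝓞 K) (span_natCast_ne_bot hl)
  rw [map_span, Set.image_singleton, map_natCast] at h
  rw [h, primesOverProd, finprod_mem_eq_toFinset_prod, ← Finset.prod_pow]
  refine Finset.prod_congr rfl fun P hP => ?_
  rw [Set.mem_toFinset] at hP
  have := hP.1
  have := hP.2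
  rw [ramificationIdxIn_eq_ramificationIdx _ P Gal(K/ℚ)]

theorem card_inertia_eq {l : ℕ} (hl : l.Prime) {P : Ideal (𝓞 K)}
    (hP : P ∈ (span {(l : ℤ)}).primesOver (𝓞 K)) :
    Nat.card (P.inertia Gal(K/ℚ)) = (span {(l : ℤ)}).ramificationIdxIn (𝓞 K) := by
  have := hP.1
  have := hP.2
  have := isMaximal_span_natCast hl
  exact card_inertia_eq_ramificationIdxIn (span {(l : ℤ)}) P

/-- The product of the primes above `l` is principal if the ramification index is one, or if it is
at most two and `l` is a unit times a square. -/
theorem isPrincipal_primesOverProd {l : ℕ} (hl : l.Prime) {P : Ideal (𝓞 K)}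
    (hP : P ∈ (span {(l : ℤ)}).primesOver (𝓞 K))
    (h : Nat.card (P.inertia Gal(K/ℚ)) ≤ 1 ∨
      Nat.card (P.inertia Gal(K/ℚ)) ≤ 2 ∧ IsUnitMulSq K l) :
    (primesOverProd K l).IsPrincipal := by
  have hpos : 0 < Nat.card (P.inertia Gal(K/ℚ)) := Nat.card_pos
  have hpow := span_natCast_eq_primesOverProd_pow (K := K) hl
  rw [← card_inertia_eq hl hP] at hpow
  obtain h1 | ⟨h2, h3⟩ : Nat.card (P.inertia Gal(K/ℚ)) = 1 ∨
      (Nat.card (P.inertia Gal(K/ℚ)) = 2 ∧ IsUnitMulSq K l) := by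
    by_cases h1 : Nat.card (P.inertia Gal(K/ℚ)) = 1
    · exact .inl h1
    · exact .inr (h.elim (fun h => absurd (by omega) h1) fun h => ⟨by omega, h.2⟩)
  · rw [h1, pow_one] at hpow
    exact ⟨_, hpow.symm⟩
  · rw [h2] at hpow
    obtain ⟨x, hx⟩ := h3.exists_span_sq
    -- Ideals of `𝓞 K` have unique square roots, so `(x) ^ 2 = (l) = Π ^ 2` gives `Π = (x)`.
    exact ⟨x, (pow_left_injective two_ne_zero (hx.trans hpow)).symm⟩

/-- A criterion for a biquadratic field to be a Pólya field. -/
theorem isPolyaField_of_isUnitMulSq {a b : ℤ} {x y : K}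
    (hx : x ^ 2 = a) (hy : y ^ 2 = b) (hx0 : x ≠ 0)
    (hgen : ∀ σ τ : Gal(K/ℚ), σ x = τ x → σ y = τ y → σ = τ)
    (hab : IsCoprime a b) (h4 : b % 4 = 1 ∨ (a * b) % 4 = 1)
    (h : ∀ l : ℕ, l.Prime → (l : ℤ) ∣ 2 * a * b → IsUnitMulSq K l) : IsPolyaField K := by
  intro l f hl _
  obtain h1 | h1 := ostrowskiIdeal_eq_one_or (K := K) hl f
  · rw [h1, one_eq_top]
    exact top_isPrincipal
  rw [h1]
  obtain ⟨P, hP⟩ := exists_mem_primesOver (K := K) hl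
  refine isPrincipal_primesOverProd hl hP ?_
  have hl' := Nat.prime_iff_prime_int.mp hl
  by_cases hdvd : (l : ℤ) ∣ 2 * a * b
  · refine .inr ⟨?_, h l hl hdvd⟩
    by_cases hl2 : l = 2
    · subst hl2
      -- At `2`, inertia fixes `y` or `x * y`, whichever has square `1` modulo `4`.
      rcases h4 with h4 | h4
      · exact card_inertia_le_two hx hgen fun σ hσ =>
          apply_eq_of_mem_inertia_of_emod_four hP hy h4 (by omega) hσ
      · refine card_inertia_le_two (z := x * y) hx (fun σ τ h₁ h₂ => hgen σ τ h₁ ?_) fun σ hσ =>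
          apply_eq_of_mem_inertia_of_emod_four hP (a := a * b) (by push_cast; rw [← hx, ← hy]; ring)
            h4 (by omega) hσ
        rw [map_mul, map_mul, h₁] at h₂
        exact mul_left_cancel₀ ((map_ne_zero τ).mpr hx0) h₂
    · have hl2' : ¬ (l : ℤ) ∣ 2 := by
        intro h
        exact hl2 ((Nat.prime_dvd_prime_iff_eq hl Nat.prime_two).mp (by exact_mod_cast h))
      by_cases hla : (l : ℤ) ∣ a
      · refine card_inertia_le_two hx hgen fun σ hσ =>
          apply_eq_of_mem_inertia hP hy hl' hl2' (fun hlb => ?_) hσ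
        exact hl'.not_isUnit (hab.isUnit_of_dvd' hla hlb)
      · exact card_inertia_le_two hy (fun σ τ h₁ h₂ => hgen σ τ h₂ h₁) fun σ hσ =>
          apply_eq_of_mem_inertia hP hx hl' hl2' hla hσ
  · rw [hl'.dvd_mul, hl'.dvd_mul] at hdvd
    push Not at hdvd
    left
    have : Subsingleton (P.inertia Gal(K/ℚ)) := by
      refine ⟨fun σ τ => Subtype.ext (hgen _ _ ?_ ?_)⟩
      · rw [apply_eq_of_mem_inertia hP hx hl' hdvd.1.1 hdvd.1.2 σ.2,
          apply_eq_of_mem_inertia hP hx hl' hdvd.1.1 hdvd.1.2 τ.2]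
      · rw [apply_eq_of_mem_inertia hP hy hl' hdvd.1.1 hdvd.2 σ.2,
          apply_eq_of_mem_inertia hP hy hl' hdvd.1.1 hdvd.2 τ.2]
    exact Finite.card_le_one_iff_subsingleton.mpr this

end Galois

/-! ### Units times squares -/

section UnitMulSq

open NumberField

variable {K : Type*} [Field K] [NumberField K]

theorem IsUnitMulSq.mul {m n : ℕ} (hm : IsUnitMulSq K m) (hn : IsUnitMulSq K n) :
    IsUnitMulSq K (m * n) := by
  obtain ⟨x, u, hx, h⟩ := hm
  obtain ⟨y, v, hy, h'⟩ := hn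
  refine ⟨x * y, u * v, mul_ne_zero hx hy, ?_⟩
  rw [mul_pow, h, h', Units.val_mul, map_mul, Nat.cast_mul]
  ring

theorem IsUnitMulSq.of_mul_left {m n : ℕ} (hmn : IsUnitMulSq K (m * n)) (hm : IsUnitMulSq K m) :
    IsUnitMulSq K n := by
  obtain ⟨x, u, hx, h⟩ := hmn
  obtain ⟨y, v, hy, h'⟩ := hm
  refine ⟨x / y, u * v⁻¹, div_ne_zero hx hy, ?_⟩
  have hv : algebraMap (𝓞 K) K v * algebraMap (𝓞 K) K (v⁻¹ : (𝓞 K)ˣ) = 1 := by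
    rw [← map_mul, ← Units.val_mul, mul_inv_cancel, Units.val_one, map_one]
  rw [div_pow, div_eq_iff (pow_ne_zero 2 hy), h, h', Units.val_mul, map_mul, Nat.cast_mul]
  linear_combination (-(m : K) * n * algebraMap (𝓞 K) K u) * hv

theorem IsUnitMulSq.mul_iff_left {m n : ℕ} (hm : IsUnitMulSq K m) :
    IsUnitMulSq K (m * n) ↔ IsUnitMulSq K n :=
  ⟨fun h => h.of_mul_left hm, hm.mul⟩

theorem IsUnitMulSq.mul_iff_right {m n : ℕ} (hn : IsUnitMulSq K n) :
    IsUnitMulSq K (m * n) ↔ IsUnitMulSq K m := by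
  rw [mul_comm, hn.mul_iff_left]

theorem isUnitMulSq_of_sq_eq {n : ℕ} {x : K} (hn : n ≠ 0) (hx : x ^ 2 = n) : IsUnitMulSq K n := by
  refine ⟨x, 1, ?_, by simpa using hx⟩
  rintro rfl
  exact hn (by simpa using hx.symm)

/-- A root of `X ^ 2 - N * X + 1` is a unit of the ring of integers. -/
theorem exists_unit_of_mul_sub_eq_one {K : Type*} [Field K] [CharZero K] {x : K} {N : ℤ} (h : x * (N - x) = 1) :
    ∃ u : (𝓞 K)ˣ, algebraMap (𝓞 K) K u = x := by
  have hint : IsIntegral ℤ x := by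
    refine ⟨.X ^ 2 - .C N * .X + .C 1, by monicity!, ?_⟩
    rw [← Polynomial.aeval_def]
    simp only [map_add, map_sub, map_mul, map_pow, Polynomial.aeval_X, eq_intCast,
      map_intCast, map_one]
    linear_combination -h
  obtain ⟨y, rfl⟩ : ∃ y : 𝓞 K, algebraMap (𝓞 K) K y = x := ⟨⟨x, hint⟩, rfl⟩
  have : y * (N - y) = 1 := by
    apply FaithfulSMul.algebraMap_injective (𝓞 K) K
    simpa using h
  exact ⟨Units.mkOfMulEqOne _ _ this, rfl⟩

/-- A solution of `a * u ^ 2 = b * v ^ 2 + c` with `c ∣ 2` makes `a * c` a unit times a square in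
fields containing a square root of `a * b`. -/
theorem isUnitMulSq_of_eq_add {a b u v c : ℕ} {z : K} (hz : z ^ 2 = a * b) (ha : a ≠ 0)
    (hc : c ∣ 2) (h : a * u ^ 2 = b * v ^ 2 + c) : IsUnitMulSq K (a * c) := by
  obtain ⟨d, hd⟩ := hc
  have hd' : (c : K) * d = 2 := by exact_mod_cast hd.symm
  have hc0 : (c : K) ≠ 0 := by
    rintro h0
    rw [h0, zero_mul] at hd'
    exact two_ne_zero hd'.symm
  have ha0 : (a : K) ≠ 0 := by exact_mod_cast ha
  have h' : (a : K) * u ^ 2 = b * v ^ 2 + c := by exact_mod_cast h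
  -- The unit is `(a * u + v * z) ^ 2 / (a * c)`. Changing the sign of `z` gives its inverse, as
  -- their product is `(a * u ^ 2 - b * v ^ 2) ^ 2 / c ^ 2 = 1`; their sum `N` is an integer because
  -- `c ∣ 2`.
  obtain ⟨w, hw⟩ := exists_unit_of_mul_sub_eq_one (K := K) (N := d * (a * u ^ 2 + b * v ^ 2))
    (x := (a * u ^ 2 + b * v ^ 2 + 2 * u * v * z) / c) (by
      have hd'' : (d : K) = 2 / c := by rw [eq_div_iff hc0, mul_comm, hd']
      push_cast
      rw [hd'']
      field_simp
      linear_combination (-4 * (u : K) ^ 2 * v ^ 2) * hz + (a * u ^ 2 - b * v ^ 2 + c : K) * h')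
  refine ⟨a * u + v * z, w, fun h0 => ?_, ?_⟩
  · have : (a : K) * c = 0 := by
      linear_combination (a * u - v * z) * h0 - (a : K) * h' + (v : K) ^ 2 * hz
    exact mul_ne_zero ha0 hc0 this
  · rw [hw]
    push_cast
    field_simp
    linear_combination (v : K) ^ 2 * hz

end UnitMulSq

/-! ### Factoring the least solution of a Pell equation -/

section Pell

/-- Take `a = gcd n A` and `b = gcd n B`. By coprimality their product is `gcd n (A * B) = n`, and
the cofactors are coprime with product `w ^ 2`, hence squares. -/
theorem exists_mul_sq_of_mul_eq {A B n w : ℕ} (hn : n ≠ 0) (hAB : A.Coprime B)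
    (h : A * B = n * w ^ 2) :
    ∃ a b u v : ℕ, a * b = n ∧ A = a * u ^ 2 ∧ B = b * v ^ 2 := by
  have hmul : n.gcd A * n.gcd B = n := by
    rw [← hAB.gcd_mul, h, Nat.gcd_mul_right_right]
  obtain ⟨A', hA⟩ := n.gcd_dvd_right A
  obtain ⟨B', hB⟩ := n.gcd_dvd_right B
  have hw : A' * B' = w ^ 2 := by
    apply Nat.eq_of_mul_eq_mul_left (Nat.pos_of_ne_zero hn)
    rw [← h]
    conv_lhs => rw [← hmul]
    conv_rhs => rw [hA, hB]
    ring
  have hcop : A'.Coprime B' := (hAB.coprime_dvd_left ⟨_, by rw [mul_comm]; exact hA⟩).coprime_dvd_right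
    ⟨_, by rw [mul_comm]; exact hB⟩
  obtain ⟨u, hu⟩ := exists_eq_pow_of_mul_eq_pow (Nat.isUnit_iff.mpr hcop) hw
  obtain ⟨v, hv⟩ := exists_eq_pow_of_mul_eq_pow (Nat.isUnit_iff.mpr hcop.symm)
    ((mul_comm _ _).trans hw)
  exact ⟨_, _, u, v, hmul, hu ▸ hA, hv ▸ hB⟩

/-- Descent from the smallest solution of the Pell equation. -/
theorem exists_mul_sq_eq_mul_sq_add {n : ℕ} (hodd : Odd n) (hsq : ¬ IsSquare n) :
    ∃ a b u v : ℕ, a * b = n ∧ ((a * u ^ 2 = b * v ^ 2 + 1 ∧ a ≠ 1) ∨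
      (a * u ^ 2 = b * v ^ 2 + 2 ∧ n % 4 ≠ 1)) := by
  have hpos : 0 < n := hodd.pos
  have hex : ∃ y : ℕ, 0 < y ∧ ∃ x : ℕ, x ^ 2 = n * y ^ 2 + 1 := by
    obtain ⟨x, y, h, hy⟩ := Pell.exists_of_not_isSquare (d := n) (by exact_mod_cast hpos)
      (by simpa using hsq)
    refine ⟨y.natAbs, Int.natAbs_pos.mpr hy, x.natAbs, ?_⟩
    zify
    rw [sq_abs, sq_abs]
    linear_combination h
  classical
  obtain ⟨hy, x, hx⟩ := Nat.find_spec hex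
  have hmin := fun {m} => Nat.find_min hex (m := m)
  set y := Nat.find hex
  rcases Nat.even_or_odd y with ⟨w, hw⟩ | hyodd
  · have hxodd : Odd x := by
      rw [← Nat.not_even_iff_odd]
      intro hxe
      have : Even (x ^ 2) := hxe.pow_of_ne_zero two_ne_zero
      rw [hx, hw] at this
      exact (Nat.not_even_iff_odd.mpr ⟨n * (2 * w ^ 2), by ring⟩) this
    obtain ⟨k, rfl⟩ := hxodd
    -- With `x = 2 * k + 1` and `y = 2 * w`, the equation divides by `4`.
    have hk : (k + 1) * k = n * w ^ 2 := by
      rw [hw] at hx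
      nlinarith
    obtain ⟨a, b, u, v, hab, hA, hB⟩ := exists_mul_sq_of_mul_eq hpos.ne'
      (by simp) hk
    refine ⟨a, b, u, v, hab, .inl ⟨by omega, ?_⟩⟩
    rintro rfl
    rw [one_mul] at hab hA
    subst hab
    have hv : 0 < v := by
      rcases Nat.eq_zero_or_pos v with rfl | hv
      · simp only [hB, ne_eq, OfNat.ofNat_ne_zero, not_false_eq_true, zero_pow, mul_zero] at hk
        have : w = 0 := by simpa [hpos.ne'] using hk.symm
        omega
      · exact hv
    -- If `a = 1`, then `u ^ 2 = n * v ^ 2 + 1` with `0 < v ≤ w < y`, against minimality of `y`.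
    refine hmin (m := v) ?_ ⟨hv, u, by rw [← hA, hB]⟩
    have hvw : v ^ 2 ≤ w ^ 2 := by
      apply Nat.le_of_mul_le_mul_left _ hpos
      rw [← hk, ← hB]
      nlinarith
    have := (Nat.pow_le_pow_iff_left two_ne_zero).mp hvw
    omega
  · have hxe : Even x := by
      rw [← Nat.not_odd_iff_even]
      intro hxo
      exact (Nat.not_even_iff_odd.mpr (hxo.pow (n := 2)))
        (hx ▸ (hodd.mul (hyodd.pow (n := 2))).add_odd odd_one)
    obtain ⟨k, rfl⟩ := hxe
    obtain ⟨j, rfl⟩ : ∃ j, k = j + 1 := Nat.exists_eq_succ_of_ne_zero (by rintro rfl; simp at hx)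
    -- Now `x = 2 * j + 2`, and `x + 1`, `x - 1` are odd and differ by `2`, hence coprime.
    have hk : (2 * j + 3) * (2 * j + 1) = n * y ^ 2 := by nlinarith
    have hcop : (2 * j + 3).Coprime (2 * j + 1) := by
      have : (2 * j + 3) = 2 + (2 * j + 1) := by ring
      rw [this, Nat.coprime_add_self_left, Nat.coprime_two_left]
      exact ⟨j, rfl⟩
    obtain ⟨a, b, u, v, hab, hA, hB⟩ := exists_mul_sq_of_mul_eq hpos.ne' hcop hk
    refine ⟨a, b, u, v, hab, .inr ⟨by omega, fun h4 => ?_⟩⟩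
    -- Modulo `4` the left side of `hk` is `3`, while `n * y ^ 2` would be `1`.
    obtain ⟨i, hi⟩ := hyodd
    have := congrArg (· % 4) hk
    rw [hi] at this
    simp [Nat.mul_mod, Nat.pow_mod, Nat.add_mod, h4] at this
    have h1 : i % 4 < 4 := Nat.mod_lt _ (by norm_num)
    have h2 : j % 4 < 4 := Nat.mod_lt _ (by norm_num)
    interval_cases i % 4 <;> interval_cases j % 4 <;> simp_all

end Pell

/-! ### Legendre symbol obstructions -/

section Legendre

theorem legendreSym_ne_neg_one_of_dvd {l : ℕ} [Fact l.Prime] {w d : ℤ} (h : (l : ℤ) ∣ w ^ 2 - d) :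
    legendreSym l d ≠ -1 := by
  rw [Ne, legendreSym.eq_neg_one_iff, not_not]
  refine ⟨w, ?_⟩
  rw [← Int.cast_mul, eq_comm, ← sub_eq_zero, ← Int.cast_sub, ZMod.intCast_zmod_eq_zero_iff_dvd,
    ← sq]
  exact h

/-- Splitting off a prime factor of the left hand side of `a * b = l * m` restricts the solutions
of `A * u ^ 2 = B * v ^ 2 + c`, where `a ∣ A` and `b ∣ B`. -/
theorem eq_mul_of_mul_eq {l : ℕ} [hl : Fact l.Prime] {a b m A B u v c : ℕ} (hab : a * b = l * m)
    (hA : a ∣ A) (hB : b ∣ B) (h : A * u ^ 2 = B * v ^ 2 + c) :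
    (∃ a', a = l * a' ∧ a' * b = m ∧ a' ∣ A ∧ b ∣ B ∧ legendreSym l (-1) * legendreSym l (B * c) ≠ -1) ∨
      ∃ b', b = l * b' ∧ a * b' = m ∧ a ∣ A ∧ b' ∣ B ∧ legendreSym l (A * c) ≠ -1 := by
  have h' : (A : ℤ) * u ^ 2 = B * v ^ 2 + c := by exact_mod_cast h
  have hpos : 0 < l := hl.out.pos
  rcases hl.out.dvd_mul.mp (Dvd.intro m hab.symm) with ⟨k, rfl⟩ | ⟨k, rfl⟩
  · refine .inl ⟨k, rfl, Nat.eq_of_mul_eq_mul_left hpos (by rw [← hab]; ring),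
      (Dvd.intro_left l rfl).trans hA, hB, ?_⟩
    obtain ⟨e, rfl⟩ := hA
    rw [← legendreSym.mul]
    -- As `l ∣ A`, multiplying the equation by `B` gives `(B * v) ^ 2 ≡ -(B * c)` modulo `l`. `A`
    -- and `B` stay fixed while `a` and `b` lose their primes, so the symbols always see the full
    -- coefficients.
    refine legendreSym_ne_neg_one_of_dvd (w := B * v) ⟨B * (k * e * u ^ 2), ?_⟩
    push_cast at h'
    linear_combination -(B : ℤ) * h'
  · refine .inr ⟨k, rfl, Nat.eq_of_mul_eq_mul_left hpos (by rw [← hab]; ring),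
      hA, (Dvd.intro_left l rfl).trans hB, ?_⟩
    obtain ⟨e, rfl⟩ := hB
    refine legendreSym_ne_neg_one_of_dvd (w := A * u) ⟨A * (k * e * v ^ 2), ?_⟩
    push_cast at h'
    linear_combination (A : ℤ) * h'

theorem legendreSym_neg_one {l : ℕ} [Fact l.Prime] (hl : l % 4 = 3) : legendreSym l (-1) = -1 := by
  rw [legendreSym.at_neg_one (by omega), ZMod.χ₄_nat_three_mod_four hl]

theorem legendreSym_eq_one_or {l m : ℕ} [hl : Fact l.Prime] [hm : Fact m.Prime] (h : l ≠ m) :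
    legendreSym l m = 1 ∨ legendreSym l m = -1 := by
  apply legendreSym.eq_one_or_neg_one
  rw [Int.cast_natCast, Ne, ZMod.natCast_eq_zero_iff, Nat.prime_dvd_prime_iff_eq hl.out hm.out]
  exact h

end Legendre

/-! ### Elimination of the impossible factorizations -/

section Cases

open NumberField

variable {K : Type*} [Field K] [NumberField K]

theorem not_isSquare_of_dvd {l n : ℕ} (hl : l.Prime) (h : l ∣ n) (h2 : ¬ l ^ 2 ∣ n) :
    ¬ IsSquare n := by
  rintro ⟨k, rfl⟩
  refine h2 ?_
  rw [sq]
  have := (hl.dvd_mul.mp h)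
  exact mul_dvd_mul (this.elim id id) (this.elim id id)

theorem not_isSquare_prime_mul {l m : ℕ} (hl : l.Prime) (h : ¬ l ∣ m) : ¬ IsSquare (l * m) := by
  refine not_isSquare_of_dvd hl (dvd_mul_right l m) fun h2 => h ?_
  rw [sq] at h2
  exact Nat.dvd_of_mul_dvd_mul_left hl.pos h2

/-- For `n = p`, the case `c = 1` would force `a = p` and make `-1` a square modulo `p`. So `c = 2`
with `a = 1` or `a = p`, and `p` is itself a square in `K`. -/
theorem isUnitMulSq_two {p : ℕ} [hp : Fact p.Prime] (hp4 : p % 4 = 3) {x : K}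
    (hx : x ^ 2 = p) : IsUnitMulSq K 2 := by
  have hp0 := hp.out.ne_zero
  have hodd : Odd p := by rw [Nat.odd_iff]; omega
  have hsq : ¬ IsSquare p := hp.out.prime.not_isSquare
  have hS : IsUnitMulSq K p := isUnitMulSq_of_sq_eq hp0 hx
  have hneg := legendreSym_neg_one hp4
  obtain ⟨a, b, u, v, hab, h⟩ := exists_mul_sq_eq_mul_sq_add hodd hsq
  have ha : a ≠ 0 := by rintro rfl; simp at hab; omega
  have hz : x ^ 2 = (a : K) * b := by rw [hx, ← hab, Nat.cast_mul]
  rcases h with ⟨h, ha1⟩ | ⟨h, -⟩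
  · rcases eq_mul_of_mul_eq (l := p) (m := 1) (by rw [hab, mul_one]) dvd_rfl dvd_rfl h with
      ⟨a', rfl, h1, -, -, hne⟩ | ⟨b', rfl, h1, -, -, hne⟩
    · rw [(mul_eq_one.mp h1).2] at hne
      simp [hneg] at hne
    · exact absurd (mul_eq_one.mp h1).1 ha1
  · have hS2 := isUnitMulSq_of_eq_add hz ha dvd_rfl h
    rcases hp.out.eq_one_or_self_of_dvd a (Dvd.intro b hab) with rfl | rfl
    · simpa using hS2
    · exact hS2.of_mul_left hS


/-- The descent for `q * r * s` under the first set of conditions. -/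
theorem eq_mul_of_legendreSym {n q r s a b u v : ℕ} [Fact q.Prime] [Fact r.Prime] [Fact s.Prime]
    (nq : legendreSym q (-1) = -1) (nr : legendreSym r (-1) = -1) (ns : legendreSym s (-1) = -1)
    (h2r : legendreSym r 2 = 1 ∧ legendreSym s 2 = -1 ∨ legendreSym r 2 = -1 ∧ legendreSym s 2 = 1)
    (hrq : legendreSym r q = 1) (hsq : legendreSym s q = 1) (hsr : legendreSym s r = 1)
    (hqr : legendreSym q r = -1) (hqs : legendreSym q s = -1) (hrs : legendreSym r s = -1)
    (hab : a * b = q * (r * (s * 1)))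
    (h : (a * u ^ 2 = b * v ^ 2 + 1 ∧ a ≠ 1) ∨ (a * u ^ 2 = b * v ^ 2 + 2 ∧ n % 4 ≠ 1)) :
    a = q * r ∧ a * u ^ 2 = b * v ^ 2 + 1 := by
  rcases h with ⟨h, ha⟩ | ⟨h, ha⟩ <;>
  rcases eq_mul_of_mul_eq hab dvd_rfl dvd_rfl h with
    ⟨x₁, h₁, g₁, hA₁, hB₁, n₁⟩ | ⟨x₁, h₁, g₁, hA₁, hB₁, n₁⟩ <;>
  rcases eq_mul_of_mul_eq g₁ hA₁ hB₁ h with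
    ⟨x₂, h₂, g₂, hA₂, hB₂, n₂⟩ | ⟨x₂, h₂, g₂, hA₂, hB₂, n₂⟩ <;>
  rcases eq_mul_of_mul_eq g₂ hA₂ hB₂ h with
    ⟨x₃, h₃, g₃, -, -, n₃⟩ | ⟨x₃, h₃, g₃, -, -, n₃⟩ <;>
  -- The trailing factor `1` in `hab` leaves cofactors with product `1` once all primes are split
  -- off, so `a` and `b` are now explicit.
  obtain ⟨h₄, h₅⟩ := mul_eq_one.mp g₃ <;>
  subst_vars <;>
  rcases h2r with ⟨h2r, h2s⟩ | ⟨h2r, h2s⟩ <;>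
  simp [legendreSym.mul, *] at n₁ n₂ n₃ ha ⊢ <;>
  simpa using h

/-- The descent for `q * r * s` under the second set of conditions. -/
theorem eq_or_eq_mul_of_legendreSym {n q r s a b u v : ℕ} [Fact q.Prime] [Fact r.Prime]
    [Fact s.Prime]
    (nq : legendreSym q (-1) = -1) (nr : legendreSym r (-1) = -1) (ns : legendreSym s (-1) = -1)
    (h2 : legendreSym r 2 = 1 ∧ legendreSym s 2 = 1 ∧ legendreSym q 2 = -1 ∨
      legendreSym r 2 = -1 ∧ legendreSym s 2 = -1 ∧ legendreSym q 2 = 1)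
    (hrq : legendreSym r q = 1) (hsq : legendreSym s q = -1) (hsr : legendreSym s r = 1)
    (hqr : legendreSym q r = -1) (hqs : legendreSym q s = 1) (hrs : legendreSym r s = -1)
    (hab : a * b = q * (r * (s * 1)))
    (h : (a * u ^ 2 = b * v ^ 2 + 1 ∧ a ≠ 1) ∨ (a * u ^ 2 = b * v ^ 2 + 2 ∧ n % 4 ≠ 1)) :
    (a = r ∨ a = q * s) ∧ a * u ^ 2 = b * v ^ 2 + 2 := by
  rcases h with ⟨h, ha⟩ | ⟨h, ha⟩ <;>
  rcases eq_mul_of_mul_eq hab dvd_rfl dvd_rfl h with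
    ⟨x₁, h₁, g₁, hA₁, hB₁, n₁⟩ | ⟨x₁, h₁, g₁, hA₁, hB₁, n₁⟩ <;>
  rcases eq_mul_of_mul_eq g₁ hA₁ hB₁ h with
    ⟨x₂, h₂, g₂, hA₂, hB₂, n₂⟩ | ⟨x₂, h₂, g₂, hA₂, hB₂, n₂⟩ <;>
  rcases eq_mul_of_mul_eq g₂ hA₂ hB₂ h with
    ⟨x₃, h₃, g₃, -, -, n₃⟩ | ⟨x₃, h₃, g₃, -, -, n₃⟩ <;>
  obtain ⟨h₄, h₅⟩ := mul_eq_one.mp g₃ <;>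
  subst_vars <;>
  rcases h2 with ⟨h2r, h2s, h2q⟩ | ⟨h2r, h2s, h2q⟩ <;>
  simp [legendreSym.mul, *] at n₁ n₂ n₃ ha ⊢ <;>
  simpa using h

/-- The descent for `p * q * r * s` under the first set of conditions. -/
theorem isUnitMulSq_or_of_legendreSym {p q r s a b u v : ℕ} [Fact p.Prime] [Fact q.Prime]
    [Fact r.Prime] [Fact s.Prime]
    (np : legendreSym p (-1) = -1) (nr : legendreSym r (-1) = -1)
    (hrq : legendreSym r q = 1)
    (hqr : legendreSym q r = -1) (hqs : legendreSym q s = -1)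
    (hqp : legendreSym q p = 1) (hrp : legendreSym r p = -1)
    (hpq : legendreSym p q = -1) (hpr : legendreSym p r = 1) (hps : legendreSym p s = 1)
    (hSs : IsUnitMulSq K s) (hSa : IsUnitMulSq K a)
    (hab : a * b = p * (q * (r * (s * 1)))) (h : a * u ^ 2 = b * v ^ 2 + 1) (ha : a ≠ 1) :
    IsUnitMulSq K q ∨ IsUnitMulSq K r := by
  -- The symbols modulo `p` force `q ∣ b`, those modulo `q` put `r` and `s` on the same side, and
  -- those modulo `r` with `a ≠ 1` leave only `a = r * s`.
  rcases eq_mul_of_mul_eq hab dvd_rfl dvd_rfl h with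
    ⟨x₁, h₁, g₁, hA₁, hB₁, n₁⟩ | ⟨x₁, h₁, g₁, hA₁, hB₁, n₁⟩ <;>
  rcases eq_mul_of_mul_eq g₁ hA₁ hB₁ h with
    ⟨x₂, h₂, g₂, hA₂, hB₂, n₂⟩ | ⟨x₂, h₂, g₂, hA₂, hB₂, n₂⟩ <;>
  rcases eq_mul_of_mul_eq g₂ hA₂ hB₂ h with
    ⟨x₃, h₃, g₃, hA₃, hB₃, n₃⟩ | ⟨x₃, h₃, g₃, hA₃, hB₃, n₃⟩ <;>
  rcases eq_mul_of_mul_eq g₃ hA₃ hB₃ h with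
    ⟨x₄, h₄, g₄, -, -, n₄⟩ | ⟨x₄, h₄, g₄, -, -, n₄⟩ <;>
  obtain ⟨h₅, h₆⟩ := mul_eq_one.mp g₄ <;>
  subst_vars <;>
  simp [legendreSym.mul, hSs.mul_iff_right, *] at n₁ n₂ n₃ n₄ ha hSa ⊢
  tauto

/-- The descent for `p * q * r * s` under the second set of conditions. -/
theorem isUnitMulSq_or_of_legendreSym' {p q r s a b u v : ℕ} [Fact p.Prime] [Fact q.Prime]
    [Fact r.Prime] [Fact s.Prime]
    (np : legendreSym p (-1) = -1) (nq : legendreSym q (-1) = -1)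
    (hrq : legendreSym r q = 1)
    (hqr : legendreSym q r = -1) (hqs : legendreSym q s = 1) (hrs : legendreSym r s = -1)
    (hpq : legendreSym q p = 1 ∧ legendreSym p q = -1 ∨ legendreSym q p = -1 ∧ legendreSym p q = 1)
    (hrp : legendreSym r p = 1)
    (hpr : legendreSym p r = -1) (hps : legendreSym p s = 1)
    (hSp : IsUnitMulSq K p) (hSa : IsUnitMulSq K a)
    (hab : a * b = p * (q * (r * (s * 1)))) (h : a * u ^ 2 = b * v ^ 2 + 1) (ha : a ≠ 1) :
    IsUnitMulSq K q ∨ IsUnitMulSq K s := by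
  -- The symbols modulo `r` force `s ∣ b`; those modulo `p` and `q` with `a ≠ 1` then leave only `a
  -- = p * q`, whichever sign `hpq` gives.
  rcases eq_mul_of_mul_eq hab dvd_rfl dvd_rfl h with
    ⟨x₁, h₁, g₁, hA₁, hB₁, n₁⟩ | ⟨x₁, h₁, g₁, hA₁, hB₁, n₁⟩ <;>
  rcases eq_mul_of_mul_eq g₁ hA₁ hB₁ h with
    ⟨x₂, h₂, g₂, hA₂, hB₂, n₂⟩ | ⟨x₂, h₂, g₂, hA₂, hB₂, n₂⟩ <;>
  rcases eq_mul_of_mul_eq g₂ hA₂ hB₂ h with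
    ⟨x₃, h₃, g₃, hA₃, hB₃, n₃⟩ | ⟨x₃, h₃, g₃, hA₃, hB₃, n₃⟩ <;>
  rcases eq_mul_of_mul_eq g₃ hA₃ hB₃ h with
    ⟨x₄, h₄, g₄, -, -, n₄⟩ | ⟨x₄, h₄, g₄, -, -, n₄⟩ <;>
  obtain ⟨h₅, h₆⟩ := mul_eq_one.mp g₄ <;>
  subst_vars <;>
  rcases hpq with ⟨hqp, hpq⟩ | ⟨hqp, hpq⟩ <;>
  simp [legendreSym.mul, hSp.mul_iff_left, *]
    at n₁ n₂ n₃ n₄ ha hSa ⊢ <;>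
  tauto

end Cases

/-! ### The field `ℚ(√a, √b)` is Galois -/

section AdjoinSqrts

open NumberField IntermediateField

theorem sqrt_mem_adjoinSqrts_left (a b : ℕ) : Real.sqrt a ∈ adjoinSqrts a b :=
  subset_adjoin _ _ (by simp)

theorem sqrt_mem_adjoinSqrts_right (a b : ℕ) : Real.sqrt b ∈ adjoinSqrts a b :=
  subset_adjoin _ _ (by simp)

theorem splits_minpoly_sqrt {F : IntermediateField ℚ ℝ} {a : ℕ} (h : Real.sqrt a ∈ F) :
    ((minpoly ℚ (Real.sqrt a)).map (algebraMap ℚ F)).Splits := by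
  have hdvd : minpoly ℚ (Real.sqrt a) ∣ .X ^ 2 - Polynomial.C (a : ℚ) := by
    apply minpoly.dvd
    simp [Real.sq_sqrt (Nat.cast_nonneg a)]
  have hfac : (Polynomial.X ^ 2 - Polynomial.C (a : ℚ)).map (algebraMap ℚ F) =
      (Polynomial.X - Polynomial.C ⟨Real.sqrt a, h⟩) *
        (Polynomial.X + Polynomial.C ⟨Real.sqrt a, h⟩) := by
    have : (⟨Real.sqrt a, h⟩ : F) ^ 2 = a := Subtype.ext (Real.sq_sqrt (Nat.cast_nonneg a))
    rw [mul_comm, ← sq_sub_sq, ← Polynomial.C_pow, this]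
    simp
  refine Polynomial.Splits.of_dvd (g := (Polynomial.X ^ 2 - Polynomial.C (a : ℚ)).map (algebraMap ℚ F)) ?_ ?_
    (Polynomial.map_dvd _ hdvd)
  · rw [hfac]
    exact (Polynomial.Splits.X_sub_C _).mul (Polynomial.Splits.X_add_C _)
  · exact (Polynomial.map_ne_zero_iff (algebraMap ℚ F).injective).mpr
      (Polynomial.X_pow_sub_C_ne_zero two_pos _)

instance isGalois_adjoinSqrts (a b : ℕ) : IsGalois ℚ (adjoinSqrts a b) := by
  refine isGalois_iff.mpr ⟨inferInstance, ⟨?_⟩⟩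
  intro z
  have : minpoly ℚ z = minpoly ℚ (z : ℝ) := IntermediateField.minpoly_eq z
  rw [this]
  refine splits_of_mem_adjoin ℚ ℝ (S := {Real.sqrt a, Real.sqrt b}) ?_ z.2
  rintro x (rfl | rfl)
  · exact ⟨isIntegral_sqrt_natCast a, splits_minpoly_sqrt (sqrt_mem_adjoinSqrts_left a b)⟩
  · exact ⟨isIntegral_sqrt_natCast b, splits_minpoly_sqrt (sqrt_mem_adjoinSqrts_right a b)⟩

/-- `ℚ(√a, √b)` is generated by square roots of `a` and `b`. -/
theorem exists_sq_eq_adjoinSqrts (a b : ℕ) : ∃ x y : adjoinSqrts a b, x ^ 2 = a ∧ y ^ 2 = b ∧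
    ∀ σ τ : Gal((adjoinSqrts a b)/ℚ), σ x = τ x → σ y = τ y → σ = τ := by
  refine ⟨⟨_, sqrt_mem_adjoinSqrts_left a b⟩, ⟨_, sqrt_mem_adjoinSqrts_right a b⟩,
    Subtype.ext (Real.sq_sqrt (Nat.cast_nonneg a)), Subtype.ext (Real.sq_sqrt (Nat.cast_nonneg b)),
    fun σ τ h₁ h₂ => ?_⟩
  have : (σ : adjoinSqrts a b →ₐ[ℚ] adjoinSqrts a b) = τ := by
    refine algHom_ext_of_eq_adjoin ℚ (s := {Real.sqrt a, Real.sqrt b}) rfl ?_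
    rintro x (rfl | rfl)
    · exact h₁
    · exact h₂
  exact AlgEquiv.coe_toAlgHom_injective this

end AdjoinSqrts

/-! ### The odd primes as units times squares -/

section Descent

open NumberField

variable {K : Type*} [Field K] [NumberField K]

theorem ne_of_legendreSym_ne_zero {l m : ℕ} [Fact l.Prime] (h : legendreSym l m ≠ 0) : l ≠ m := by
  rintro rfl
  exact h ((legendreSym.eq_zero_iff l l).mpr (by simp))

theorem legendreSym_two_eq_one_or {l : ℕ} [hl : Fact l.Prime] (h : l % 4 = 3) :
    legendreSym l 2 = 1 ∨ legendreSym l 2 = -1 := by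
  have : Fact (Nat.Prime 2) := ⟨Nat.prime_two⟩
  simpa using legendreSym_eq_one_or (l := l) (m := 2) (by rintro rfl; simp at h)

theorem prime_not_dvd_mul {l m n : ℕ} (hl : l.Prime) (hm : m.Prime) (h : l ≠ m) (hn : ¬ l ∣ n) :
    ¬ l ∣ m * n := by
  rw [hl.dvd_mul, Nat.prime_dvd_prime_iff_eq hl hm]
  tauto

/-- A field containing `√(r * s)` with `r ≠ s` both congruent to `3` modulo `4`. -/
theorem isUnitMulSq_of_sq_eq_mul {r s : ℕ} [hr : Fact r.Prime] [hs : Fact s.Prime] {y : K}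
    (hr4 : r % 4 = 3) (hs4 : s % 4 = 3) (hrs : r ≠ s) (hy : y ^ 2 = r * s) :
    IsUnitMulSq K r ∧ IsUnitMulSq K s := by
  have nr := legendreSym_neg_one hr4
  have hn4 : (r * (s * 1)) % 4 = 1 := by simp [Nat.mul_mod, hr4, hs4]
  have hS : IsUnitMulSq K (r * s) :=
    isUnitMulSq_of_sq_eq (mul_ne_zero hr.out.ne_zero hs.out.ne_zero) (by exact_mod_cast hy)
  obtain ⟨a, b, u, v, hab, h⟩ := exists_mul_sq_eq_mul_sq_add (n := r * (s * 1))
    (by rw [Nat.odd_iff]; omega)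
    (not_isSquare_prime_mul hr.out (prime_not_dvd_mul hr.out hs.out hrs hr.out.not_dvd_one))
  obtain ⟨h, ha⟩ := h.resolve_right fun h => h.2 hn4
  have ha0 : a ≠ 0 := by rintro rfl; simp at h
  have hSa : IsUnitMulSq K a := by
    simpa using isUnitMulSq_of_eq_add (K := K) (z := y)
      (by rw [hy]; exact_mod_cast (hab.trans (by ring)).symm) ha0 (one_dvd 2) h
  -- `a = r * s` is impossible, since `-1` would be a square modulo `r`; so `a` is `r` or `s`.
  have key : IsUnitMulSq K r ∨ IsUnitMulSq K s := by
    rcases eq_mul_of_mul_eq hab dvd_rfl dvd_rfl h with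
      ⟨x₁, h₁, g₁, hA₁, hB₁, n₁⟩ | ⟨x₁, h₁, g₁, hA₁, hB₁, n₁⟩ <;>
    rcases eq_mul_of_mul_eq g₁ hA₁ hB₁ h with
      ⟨x₂, h₂, g₂, -, -, n₂⟩ | ⟨x₂, h₂, g₂, -, -, n₂⟩ <;>
    obtain ⟨h₃, h₄⟩ := mul_eq_one.mp g₂ <;>
    subst_vars <;>
    simp [*] at n₁ ha hSa ⊢ <;>
    tauto
  rcases key with h | h
  · exact ⟨h, hS.of_mul_left h⟩
  · exact ⟨h.mul_iff_right.mp hS, h⟩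

/-- The descent for `q * r * s` handles `q * r`, hence `s`; the one for `p * q * r * s` then
separates `q` from `r`. -/
theorem isUnitMulSq_of_legendreSym {p q r s : ℕ} [hp : Fact p.Prime] [hq : Fact q.Prime]
    [hr : Fact r.Prime] [hs : Fact s.Prime] {x y : K}
    (hp4 : p % 4 = 3) (hq4 : q % 4 = 3) (hr4 : r % 4 = 3) (hs4 : s % 4 = 3)
    (hx : x ^ 2 = p) (hy : y ^ 2 = q * r * s)
    (h2r : legendreSym r 2 = 1 ∧ legendreSym s 2 = -1 ∨ legendreSym r 2 = -1 ∧ legendreSym s 2 = 1)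
    (hrq : legendreSym r q = 1) (hsq : legendreSym s q = 1) (hsr : legendreSym s r = 1)
    (hqp : legendreSym q p = 1) (hrp : legendreSym r p = -1) (hsp : legendreSym s p = -1) :
    IsUnitMulSq K q ∧ IsUnitMulSq K r ∧ IsUnitMulSq K s := by
  have ne_rq : r ≠ q := ne_of_legendreSym_ne_zero (by simp [hrq])
  have ne_sq : s ≠ q := ne_of_legendreSym_ne_zero (by simp [hsq])
  have ne_sr : s ≠ r := ne_of_legendreSym_ne_zero (by simp [hsr])
  have ne_qp : q ≠ p := ne_of_legendreSym_ne_zero (by simp [hqp])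
  have ne_rp : r ≠ p := ne_of_legendreSym_ne_zero (by simp [hrp])
  have ne_sp : s ≠ p := ne_of_legendreSym_ne_zero (by simp [hsp])
  have hqr : legendreSym q r = -1 := by
    rw [legendreSym.quadratic_reciprocity_three_mod_four hr4 hq4, hrq]
  have hqs : legendreSym q s = -1 := by
    rw [legendreSym.quadratic_reciprocity_three_mod_four hs4 hq4, hsq]
  have hrs : legendreSym r s = -1 := by
    rw [legendreSym.quadratic_reciprocity_three_mod_four hs4 hr4, hsr]
  have hpq : legendreSym p q = -1 := by
    rw [legendreSym.quadratic_reciprocity_three_mod_four hq4 hp4, hqp]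
  have hpr : legendreSym p r = 1 := by
    rw [legendreSym.quadratic_reciprocity_three_mod_four hr4 hp4, hrp, neg_neg]
  have hps : legendreSym p s = 1 := by
    rw [legendreSym.quadratic_reciprocity_three_mod_four hs4 hp4, hsp, neg_neg]
  have hqrs : ¬ q ∣ r * (s * 1) := prime_not_dvd_mul hq.out hr.out ne_rq.symm
    (prime_not_dvd_mul hq.out hs.out ne_sq.symm hq.out.not_dvd_one)
  have hpqrs : ¬ p ∣ q * (r * (s * 1)) := prime_not_dvd_mul hp.out hq.out ne_qp.symm
    (prime_not_dvd_mul hp.out hr.out ne_rp.symm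
      (prime_not_dvd_mul hp.out hs.out ne_sp.symm hp.out.not_dvd_one))
  have hn4 : (q * (r * (s * 1))) % 4 = 3 := by simp [Nat.mul_mod, hr4, hs4, hq4]
  have hpn4 : (p * (q * (r * (s * 1)))) % 4 = 1 := by simp [Nat.mul_mod, hr4, hs4, hq4, hp4]
  have hS : IsUnitMulSq K (q * r * s) := isUnitMulSq_of_sq_eq
    (mul_ne_zero (mul_ne_zero hq.out.ne_zero hr.out.ne_zero) hs.out.ne_zero)
    (by exact_mod_cast hy)
  have hSqr : IsUnitMulSq K (q * r) := by
    obtain ⟨a, b, u, v, hab, h⟩ := exists_mul_sq_eq_mul_sq_add (n := q * (r * (s * 1)))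
      (by rw [Nat.odd_iff]; omega) (not_isSquare_prime_mul hq.out hqrs)
    obtain ⟨rfl, h⟩ := eq_mul_of_legendreSym (legendreSym_neg_one hq4) (legendreSym_neg_one hr4)
      (legendreSym_neg_one hs4) h2r hrq hsq hsr hqr hqs hrs hab h
    simpa using isUnitMulSq_of_eq_add (K := K) (z := y)
      (by rw [hy]; exact_mod_cast (hab.trans (by ring)).symm)
      (mul_ne_zero hq.out.ne_zero hr.out.ne_zero) (one_dvd 2) h
  have hSs : IsUnitMulSq K s := hS.of_mul_left hSqr
  obtain ⟨a, b, u, v, hab, h⟩ := exists_mul_sq_eq_mul_sq_add (n := p * (q * (r * (s * 1))))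
    (by rw [Nat.odd_iff]; omega) (not_isSquare_prime_mul hp.out hpqrs)
  obtain ⟨h, ha⟩ := h.resolve_right fun h => h.2 hpn4
  have ha0 : a ≠ 0 := by rintro rfl; simp at h
  have hSa : IsUnitMulSq K a := by
    simpa using isUnitMulSq_of_eq_add (K := K) (z := x * y)
      (by rw [mul_pow, hx, hy]; exact_mod_cast (hab.trans (by ring)).symm) ha0 (one_dvd 2) h
  rcases isUnitMulSq_or_of_legendreSym (legendreSym_neg_one hp4) (legendreSym_neg_one hr4)
    hrq hqr hqs hqp hrp hpq hpr hps hSs hSa hab h ha with h | h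
  · exact ⟨h, hSqr.of_mul_left h, hSs⟩
  · exact ⟨h.mul_iff_right.mp hSqr, h, hSs⟩

/-- The descent for `q * r * s` handles `2 * r` or `2 * (q * s)`. Since `√p ∈ K` handles `2`, both
`r` and `q * s` follow, and the descent for `p * q * r * s` separates `q` from `s`. -/
theorem isUnitMulSq_of_legendreSym' {p q r s : ℕ} [hp : Fact p.Prime] [hq : Fact q.Prime]
    [hr : Fact r.Prime] [hs : Fact s.Prime] {x y : K}
    (hp4 : p % 4 = 3) (hq4 : q % 4 = 3) (hr4 : r % 4 = 3) (hs4 : s % 4 = 3) (ne_pq : p ≠ q)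
    (hx : x ^ 2 = p) (hy : y ^ 2 = q * r * s)
    (h2 : legendreSym r 2 = 1 ∧ legendreSym s 2 = 1 ∧ legendreSym q 2 = -1 ∨
      legendreSym r 2 = -1 ∧ legendreSym s 2 = -1 ∧ legendreSym q 2 = 1)
    (hrq : legendreSym r q = 1) (hsr : legendreSym s r = 1) (hqs : legendreSym q s = 1)
    (hrp : legendreSym r p = 1) (hsp : legendreSym s p = -1) :
    IsUnitMulSq K q ∧ IsUnitMulSq K r ∧ IsUnitMulSq K s := by
  have ne_rq : r ≠ q := ne_of_legendreSym_ne_zero (by simp [hrq])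
  have ne_qs : q ≠ s := ne_of_legendreSym_ne_zero (by simp [hqs])
  have ne_sr : s ≠ r := ne_of_legendreSym_ne_zero (by simp [hsr])
  have ne_rp : r ≠ p := ne_of_legendreSym_ne_zero (by simp [hrp])
  have ne_sp : s ≠ p := ne_of_legendreSym_ne_zero (by simp [hsp])
  have hqr : legendreSym q r = -1 := by
    rw [legendreSym.quadratic_reciprocity_three_mod_four hr4 hq4, hrq]
  have hsq : legendreSym s q = -1 := by
    rw [legendreSym.quadratic_reciprocity_three_mod_four hq4 hs4, hqs]
  have hrs : legendreSym r s = -1 := by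
    rw [legendreSym.quadratic_reciprocity_three_mod_four hs4 hr4, hsr]
  have hpr : legendreSym p r = -1 := by
    rw [legendreSym.quadratic_reciprocity_three_mod_four hr4 hp4, hrp]
  have hps : legendreSym p s = 1 := by
    rw [legendreSym.quadratic_reciprocity_three_mod_four hs4 hp4, hsp, neg_neg]
  have hpq : legendreSym q p = 1 ∧ legendreSym p q = -1 ∨
      legendreSym q p = -1 ∧ legendreSym p q = 1 := by
    have := legendreSym.quadratic_reciprocity_three_mod_four hq4 hp4
    rcases legendreSym_eq_one_or ne_pq.symm with h | h <;> simp [this, h]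
  have hqrs : ¬ q ∣ r * (s * 1) := prime_not_dvd_mul hq.out hr.out ne_rq.symm
    (prime_not_dvd_mul hq.out hs.out ne_qs hq.out.not_dvd_one)
  have hpqrs : ¬ p ∣ q * (r * (s * 1)) := prime_not_dvd_mul hp.out hq.out ne_pq
    (prime_not_dvd_mul hp.out hr.out ne_rp.symm
      (prime_not_dvd_mul hp.out hs.out ne_sp.symm hp.out.not_dvd_one))
  have hn4 : (q * (r * (s * 1))) % 4 = 3 := by simp [Nat.mul_mod, hr4, hs4, hq4]
  have hpn4 : (p * (q * (r * (s * 1)))) % 4 = 1 := by simp [Nat.mul_mod, hr4, hs4, hq4, hp4]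
  have hSp : IsUnitMulSq K p := isUnitMulSq_of_sq_eq hp.out.ne_zero hx
  have hS : IsUnitMulSq K (q * r * s) := isUnitMulSq_of_sq_eq
    (mul_ne_zero (mul_ne_zero hq.out.ne_zero hr.out.ne_zero) hs.out.ne_zero)
    (by exact_mod_cast hy)
  have hSr : IsUnitMulSq K r := by
    obtain ⟨a, b, u, v, hab, h⟩ := exists_mul_sq_eq_mul_sq_add (n := q * (r * (s * 1)))
      (by rw [Nat.odd_iff]; omega) (not_isSquare_prime_mul hq.out hqrs)
    obtain ⟨ha, h⟩ := eq_or_eq_mul_of_legendreSym (legendreSym_neg_one hq4)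
      (legendreSym_neg_one hr4) (legendreSym_neg_one hs4) h2 hrq hsq hsr hqr hqs hrs hab h
    have ha0 : a ≠ 0 := by rintro rfl; simp at h
    have hSa : IsUnitMulSq K a :=
      (isUnitMulSq_two hp4 hx).mul_iff_right.mp (isUnitMulSq_of_eq_add (K := K) (z := y)
        (by rw [hy]; exact_mod_cast (hab.trans (by ring)).symm) ha0 dvd_rfl h)
    rcases ha with rfl | rfl
    · exact hSa
    · exact IsUnitMulSq.of_mul_left (m := q * s) (by rwa [mul_right_comm]) hSa
  have hSqs : IsUnitMulSq K (q * s) :=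
    IsUnitMulSq.of_mul_left (m := r) (by rwa [← mul_assoc, mul_comm r]) hSr
  obtain ⟨a, b, u, v, hab, h⟩ := exists_mul_sq_eq_mul_sq_add (n := p * (q * (r * (s * 1))))
    (by rw [Nat.odd_iff]; omega) (not_isSquare_prime_mul hp.out hpqrs)
  obtain ⟨h, ha⟩ := h.resolve_right fun h => h.2 hpn4
  have ha0 : a ≠ 0 := by rintro rfl; simp at h
  have hSa : IsUnitMulSq K a := by
    simpa using isUnitMulSq_of_eq_add (K := K) (z := x * y)
      (by rw [mul_pow, hx, hy]; exact_mod_cast (hab.trans (by ring)).symm) ha0 (one_dvd 2) h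
  rcases isUnitMulSq_or_of_legendreSym' (legendreSym_neg_one hp4) (legendreSym_neg_one hq4)
    hrq hqr hqs hrs hpq hrp hpr hps hSp hSa hab h ha with h | h
  · exact ⟨h, hSr, hSqs.of_mul_left h⟩
  · exact ⟨h.mul_iff_right.mp hSqs, hSr, h⟩

end Descent

/-! ### From units times squares to the Pólya property -/

section Polya

open NumberField

variable {K : Type*} [Field K] [NumberField K] [IsGalois ℚ K]

theorem prime_eq_of_dvd {l p : ℕ} (hl : l.Prime) (hp : p.Prime) (h : (l : ℤ) ∣ p) : l = p :=
  (Nat.prime_dvd_prime_iff_eq hl hp).mp (by exact_mod_cast h)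

theorem isCoprime_prime_mul {p q : ℕ} {n : ℤ} (hp : p.Prime) (hq : q.Prime) (h : p ≠ q)
    (hn : IsCoprime (p : ℤ) n) : IsCoprime (p : ℤ) (q * n) :=
  (Nat.isCoprime_iff_coprime.mpr ((Nat.coprime_primes hp hq).mpr h)).mul_right hn

theorem isPolyaField_of_distinct {p q r s : ℕ} [hp : Fact p.Prime] [hq : Fact q.Prime]
    [hr : Fact r.Prime] [hs : Fact s.Prime] {x y : K}
    (hp4 : p % 4 = 3) (hq4 : q % 4 = 3) (hr4 : r % 4 = 3) (hs4 : s % 4 = 3)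
    (hpq : p ≠ q) (hpr : p ≠ r) (hps : p ≠ s)
    (hx : x ^ 2 = p) (hy : y ^ 2 = q * r * s)
    (hgen : ∀ σ τ : Gal(K/ℚ), σ x = τ x → σ y = τ y → σ = τ)
    (h : IsUnitMulSq K q ∧ IsUnitMulSq K r ∧ IsUnitMulSq K s) : IsPolyaField K := by
  have hx0 : x ≠ 0 := by rintro rfl; simp [eq_comm, hp.out.ne_zero] at hx
  refine isPolyaField_of_isUnitMulSq (a := p) (b := q * (r * (s * 1))) (x := x) (y := y)
    (by exact_mod_cast hx) (by rw [hy]; push_cast; ring) hx0 hgen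
    (isCoprime_prime_mul hp.out hq.out hpq (isCoprime_prime_mul hp.out hr.out hpr
      (isCoprime_prime_mul hp.out hs.out hps isCoprime_one_right))) (.inr ?_) fun l hl hdvd => ?_
  · have : (p * (q * (r * (s * 1)))) % 4 = 1 := by simp [Nat.mul_mod, hp4, hq4, hr4, hs4]
    exact_mod_cast this
  · have hl' := Nat.prime_iff_prime_int.mp hl
    rw [hl'.dvd_mul, hl'.dvd_mul, hl'.dvd_mul, hl'.dvd_mul, mul_one] at hdvd
    rcases hdvd with (hdvd | hdvd) | hdvd | hdvd | hdvd
    · exact prime_eq_of_dvd hl Nat.prime_two hdvd ▸ isUnitMulSq_two hp4 hx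
    · exact prime_eq_of_dvd hl hp.out hdvd ▸ isUnitMulSq_of_sq_eq hp.out.ne_zero hx
    · exact prime_eq_of_dvd hl hq.out hdvd ▸ h.1
    · exact prime_eq_of_dvd hl hr.out hdvd ▸ h.2.1
    · exact prime_eq_of_dvd hl hs.out hdvd ▸ h.2.2

/-- Biquadratic fields generated by `√p` and `√(p * r * s)`. -/
theorem isPolyaField_of_sq_eq_mul {p r s : ℕ} [hp : Fact p.Prime] [hr : Fact r.Prime]
    [hs : Fact s.Prime] {x y : K} (hp4 : p % 4 = 3) (hr4 : r % 4 = 3) (hs4 : s % 4 = 3)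
    (hpr : p ≠ r) (hps : p ≠ s) (hrs : r ≠ s) (hx : x ^ 2 = p) (hy : y ^ 2 = p * r * s)
    (hgen : ∀ σ τ : Gal(K/ℚ), σ x = τ x → σ y = τ y → σ = τ) : IsPolyaField K := by
  have hx0 : x ≠ 0 := by rintro rfl; simp [eq_comm, hp.out.ne_zero] at hx
  have hz : (y / x) ^ 2 = r * s := by
    rw [div_pow, div_eq_iff (pow_ne_zero 2 hx0), hy, hx]
    ring
  have h := isUnitMulSq_of_sq_eq_mul hr4 hs4 hrs hz
  refine isPolyaField_of_isUnitMulSq (a := p) (b := r * (s * 1)) (x := x) (y := y / x)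
    (by exact_mod_cast hx) (by rw [hz]; push_cast; ring) hx0 (fun σ τ h₁ h₂ => hgen σ τ h₁ ?_)
    (isCoprime_prime_mul hp.out hr.out hpr
      (isCoprime_prime_mul hp.out hs.out hps isCoprime_one_right)) (.inl ?_) fun l hl hdvd => ?_
  · rw [map_div₀, map_div₀, h₁] at h₂
    exact (div_left_inj' ((map_ne_zero τ).mpr hx0)).mp h₂
  · have : (r * (s * 1)) % 4 = 1 := by simp [Nat.mul_mod, hr4, hs4]
    exact_mod_cast this
  · have hl' := Nat.prime_iff_prime_int.mp hl
    rw [hl'.dvd_mul, hl'.dvd_mul, hl'.dvd_mul, mul_one] at hdvd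
    rcases hdvd with (hdvd | hdvd) | hdvd | hdvd
    · exact prime_eq_of_dvd hl Nat.prime_two hdvd ▸ isUnitMulSq_two hp4 hx
    · exact prime_eq_of_dvd hl hp.out hdvd ▸ isUnitMulSq_of_sq_eq hp.out.ne_zero hx
    · exact prime_eq_of_dvd hl hr.out hdvd ▸ h.1
    · exact prime_eq_of_dvd hl hs.out hdvd ▸ h.2

end Polya

/-! ### Reduction by the symmetry between `r` and `s` -/

theorem theorem1p3 (p q r s : ℕ)
    [Fact p.Prime] [Fact q.Prime] [Fact r.Prime] [Fact s.Prime]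
    (hp : p ≡ 3 [MOD 4]) (hq : q ≡ 3 [MOD 4]) (hr : r ≡ 3 [MOD 4]) (hs : s ≡ 3 [MOD 4])
    (h :
      (legendreSym r 2 ≠ legendreSym s 2 ∧
        legendreSym r q = 1 ∧ legendreSym s q = 1 ∧ legendreSym q p = 1 ∧
        -legendreSym r p = 1 ∧ -legendreSym s p = 1) ∨
      ((legendreSym r 2 = legendreSym s 2 ∧ legendreSym s 2 ≠ legendreSym q 2) ∧
        (legendreSym r q = legendreSym s r ∧ legendreSym s r = legendreSym q s) ∧
        legendreSym s (p * r) = -1 ∧ legendreSym r (p * s) = -1)) :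
    IsPolyaField (adjoinSqrts p (q * r * s)) := by
  have hp4 : p % 4 = 3 := hp
  have hq4 : q % 4 = 3 := hq
  have hr4 : r % 4 = 3 := hr
  have hs4 : s % 4 = 3 := hs
  have h2q := legendreSym_two_eq_one_or hq4
  have h2r := legendreSym_two_eq_one_or hr4
  have h2s := legendreSym_two_eq_one_or hs4
  obtain ⟨x, y, hx, hy, hgen⟩ := exists_sq_eq_adjoinSqrts p (q * r * s)
  rw [Nat.cast_mul, Nat.cast_mul] at hy
  rcases h with ⟨h2, hrq, hsq, hqp, hrp, hsp⟩ | ⟨⟨h2, h2'⟩, ⟨h₁, h₂⟩, hspr, hrps⟩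
  · rw [neg_eq_iff_eq_neg] at hrp hsp
    have ne_qp : q ≠ p := ne_of_legendreSym_ne_zero (by simp [hqp])
    have ne_rp : r ≠ p := ne_of_legendreSym_ne_zero (by simp [hrp])
    have ne_sp : s ≠ p := ne_of_legendreSym_ne_zero (by simp [hsp])
    have ne_sr : s ≠ r := by rintro rfl; exact h2 rfl
    refine isPolyaField_of_distinct hp4 hq4 hr4 hs4 ne_qp.symm ne_rp.symm ne_sp.symm hx hy hgen ?_
    -- Condition (i) is symmetric in `r` and `s`, and by reciprocity exactly one of `(r/s)`, `(s/r)`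
    -- is `1`.
    rcases legendreSym_eq_one_or ne_sr with hsr | hsr
    · exact isUnitMulSq_of_legendreSym hp4 hq4 hr4 hs4 hx hy (by grind) hrq hsq hsr hqp hrp hsp
    · have hrs : legendreSym r s = 1 := by
        rw [legendreSym.quadratic_reciprocity_three_mod_four hs4 hr4, hsr, neg_neg]
      have := isUnitMulSq_of_legendreSym hp4 hq4 hs4 hr4 hx (by rw [hy]; ring) (by grind) hsq hrq
        hrs hqp hsp hrp
      tauto
  · have ne_rq : r ≠ q := by rintro rfl; exact h2' h2.symm
    have hrs := legendreSym.quadratic_reciprocity_three_mod_four hs4 hr4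
    have hsq := legendreSym.quadratic_reciprocity_three_mod_four hq4 hs4
    have hqr := legendreSym.quadratic_reciprocity_three_mod_four hr4 hq4
    rw [legendreSym.mul] at hspr hrps
    have hrq := legendreSym_eq_one_or ne_rq
    have ne_sr : s ≠ r := ne_of_legendreSym_ne_zero (by grind)
    have ne_rp : r ≠ p := ne_of_legendreSym_ne_zero (by grind)
    have ne_sp : s ≠ p := ne_of_legendreSym_ne_zero (by grind)
    -- Condition (ii) allows `p = q`; then `K = ℚ(√p, √(rs))`.
    by_cases ne_pq : p = q
    · subst ne_pq
      exact isPolyaField_of_sq_eq_mul hp4 hr4 hs4 ne_rp.symm ne_sp.symm ne_sr.symm hx hy hgen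
    refine isPolyaField_of_distinct hp4 hq4 hr4 hs4 ne_pq ne_rp.symm ne_sp.symm hx hy hgen ?_
    -- If the common value of the three symbols is `-1`, reciprocity makes it `1` after exchanging
    -- `r` and `s`.
    rcases hrq with hrq | hrq
    · exact isUnitMulSq_of_legendreSym' hp4 hq4 hr4 hs4 ne_pq hx hy (by grind) hrq (by grind)
        (by grind) (by grind) (by grind)
    · have := isUnitMulSq_of_legendreSym' hp4 hq4 hs4 hr4 ne_pq hx (by rw [hy]; ring) (by grind)
        (by grind) (by grind) (by grind) (by grind) (by grind)
      tauto
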